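/- For a real square matrix $A$ let $\|A\|$ denote its spectral norm, and let $A\circ B$ denote the entrywise product of matrices of the same size. For $i\in[n]$ let $D_i$ be the $2^n\times 2^n$ matrix indexed by $\{0,1\}^n$ with $D_i(x,y)=1$ if $x_i\neq y_i$ and $D_i(x,y)=0$ otherwise. For a Boolean function $g:\{0,1\}^n\to\{0,1\}$ let $$\mathrm{ADV}^{\pm}(g)=\max_{\Gamma}\ \|\Gamma\|,$$ the maximum being over all real $2^n\times 2^n$ matrices $\Gamma$ with $\|\Gamma\circ D_i\|\le 1$ for all $i\in[n]$ and $\Gamma(x,y)=0$ for all $x,y\in\{0,1\}^n$ with $g(x)=g(y)$. For a relation $f\subseteq\{0,1\}^n\times[K]$ such that every $x\in\{0,1\}^n$ has some $a\in[K]$ with $(x,a)\in f$, let $$\mathrm{ADV}_{rel}^{\pm}(f)=\min_{\{u_{x,i}\},\{v_{x,i}\},\{\sigma_{x,a}\}}\ \max\Big\{\max_{x}\sum_{i\in[n]}\|u_{x,i}\|^2,\ \max_{x}\sum_{i\in[n]}\|v_{x,i}\|^2\Big\},$$ the minimum being over all families of real vectors $u_{x,i},v_{x,i},\sigma_{x,a}$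 ($x\in\{0,1\}^n$, $i\in[n]$, $a\in[K]$) of arbitrary finite dimension such that $$\sum_{i:\,x_i\ne y_i}\langle u_{x,i},v_{y,i}\rangle=1-\sum_{a\in[K]}\langle\sigma_{x,a},\sigma_{y,a}\rangle\quad\text{for all }x,y\in\{0,1\}^n,$$ and $\|\sigma_{x,a}\|^2=0$ for all $x,a$ with $(x,a)\notin f$. **Theorem.** Let $f\subseteq\{0,1\}^N\times[K]$ be a relation such that for every $x\in\{0,1\}^N$ there is $a\in[K]$ with $(x,a)\in f$, and let $g:\{0,1\}^m\to\{0,1\}$ be a Boolean function. Let $f\circ g^N\subseteq\{0,1\}^{Nm}\times[K]$ be the relation consisting of all pairs $((x_1,\ldots,x_N),a)$, with each $x_p\in\{0,1\}^m$, such that $((g(x_1),\ldots,g(x_N)),a)\in f$. Then $$\mathrm{ADV}_{rel}^{\pm}(f\circ g^N)\ \ge\ \mathrm{ADV}_{rel}^{\pm}(f)\cdot\mathrm{ADV}^{\pm}(g).$$ -/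

import Mathlib

namespace RelAdv

noncomputable section

/-- Bit strings of length `n`. -/
abbrev Cube (n : ℕ) : Type := Fin n → Bool

/-- The spectral norm of a real square matrix: the operator norm with respect to the
Euclidean norm. -/
def specNorm {ι : Type*} [Fintype ι] [DecidableEq ι] (A : Matrix ι ι ℝ) : ℝ :=
  ‖Matrix.toEuclideanCLM (𝕜 := ℝ) A‖

/-- The Boolean matrix `D i`, with `D i x y = 1` iff `x i ≠ y i`. -/
def diffMatrix {n : ℕ} (i : Fin n) : Matrix (Cube n) (Cube n) ℝ :=
  Matrix.of fun x y => if x i ≠ y i then 1 else 0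

/-- The constraints of the functional adversary bound of `g`. -/
structure IsAdvFeasible {n : ℕ} (g : Cube n → Bool) (Γ : Matrix (Cube n) (Cube n) ℝ) :
    Prop where
  norm_le : ∀ i, specNorm (Matrix.hadamard Γ (diffMatrix i)) ≤ 1
  eq_zero : ∀ x y, g x = g y → Γ x y = 0

/-- The functional (negative weight) adversary bound of a Boolean function: the largest
spectral norm of a feasible matrix. -/
def adv {n : ℕ} (g : Cube n → Bool) : ℝ :=
  sSup {r | ∃ Γ : Matrix (Cube n) (Cube n) ℝ, IsAdvFeasible g Γ ∧ r = specNorm Γ}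

/-- The constraints of the relational adversary bound of `f`, for vectors `u x i`, `v x i`
in `ℝ ^ d` and vectors `σ x a` in `ℝ ^ e`. -/
structure IsRelFeasible {n K : ℕ} (f : Set (Cube n × Fin K)) {d e : ℕ}
    (u v : Cube n → Fin n → EuclideanSpace ℝ (Fin d))
    (σ : Cube n → Fin K → EuclideanSpace ℝ (Fin e)) : Prop where
  sum_eq : ∀ x y, ∑ i with x i ≠ y i, inner ℝ (u x i) (v y i) =
    1 - ∑ a, inner ℝ (σ x a) (σ y a)
  norm_sq_eq_zero : ∀ x a, (x, a) ∉ f → ‖σ x a‖ ^ 2 = 0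

/-- The objective value of the vectors `u x i`, `v x i`. -/
def relCost {n d : ℕ} (u v : Cube n → Fin n → EuclideanSpace ℝ (Fin d)) : ℝ :=
  max (⨆ x, ∑ i, ‖u x i‖ ^ 2) (⨆ x, ∑ i, ‖v x i‖ ^ 2)

/-- The relational adversary bound of a relation: the smallest objective value of feasible
families of vectors, of arbitrary finite dimensions. -/
def advRel {n K : ℕ} (f : Set (Cube n × Fin K)) : ℝ :=
  sInf {r | ∃ (d e : ℕ) (u v : Cube n → Fin n → EuclideanSpace ℝ (Fin d))
    (σ : Cube n → Fin K → EuclideanSpace ℝ (Fin e)),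
    IsRelFeasible f u v σ ∧ r = relCost u v}

/-- The `p`-th block, of length `m`, of a string of length `N * m`; its `q`-th bit is the
bit number `p * m + q` of the string (all indices counted from `0`). -/
def block {N m : ℕ} (x : Cube (N * m)) (p : Fin N) : Cube m :=
  fun q => x (finProdFinEquiv (p, q))

/-- The composed relation `f ∘ g ^ N`. -/
def compRel {N K m : ℕ} (f : Set (Cube N × Fin K)) (g : Cube m → Bool) :
    Set (Cube (N * m) × Fin K) :=
  {xa | ((fun p => g (block xa.1 p)), xa.2) ∈ f}

end

end RelAdv

/-! ### Relational adversary solutions: coordinates, cost bounds, existence -/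

namespace RelAdv

/-! A solution for `f ∘ g ^ N` is averaged into one for `f` whose cost is smaller by the factor `lam
= specNorm Γ`, for each feasible `Γ` of positive norm.

`Γ` attains its norm on one off-diagonal block, at unit vectors `d true`, `d false` supported on the
two fibres of `g`. Symmetrizing that block to `Γ'` keeps the norm at most `lam`, so `1 + lam⁻¹ • Γ'`
is a Gram matrix `Cᵀ * C`. It is the identity on each fibre, and its form equals 1 on every pair `d
b`, `d b'` (`nonempty_advWitness`).

For an outer input `z`, inner tuples `X` are superposed with amplitudes `∏ p, d (z p) (X p)`. The
vector `σ X` is tensored with the columns of `C` for `X`, one per block. In the `u` and `v` vectors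
of block `p`, the factor `C` at `p` is replaced by `1` and by the contraction `G q = Γ' ∘ D_q`
respectively. As `G q` is `lam` times the Gram matrix masked by `D_q` across fibres, the old
constraints sum to the new ones after division by `lam`. Within a fibre the remaining factors are
orthonormal, so no cost is gained (`exists_isRelFeasible_of_compRel`). -/

/-- A relational adversary solution given in coordinates over arbitrary finite index types. -/
theorem exists_isRelFeasible_of_coordinates {n K : ℕ} (f : Set (Cube n × Fin K))
    {J L : Type*} [Fintype J] [Fintype L]
    (u v : Cube n → Fin n → J → ℝ) (σ : Cube n → Fin K → L → ℝ)
    (hsum : ∀ x y, ∑ i with x i ≠ y i, ∑ j, u x i j * v y i j =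
      1 - ∑ a, ∑ l, σ x a l * σ y a l)
    (hσ : ∀ x a l, (x, a) ∉ f → σ x a l = 0) {c : ℝ}
    (hu : ∀ x, ∑ i, ∑ j, u x i j ^ 2 ≤ c) (hv : ∀ x, ∑ i, ∑ j, v x i j ^ 2 ≤ c) :
    ∃ (d e : ℕ) (u' v' : Cube n → Fin n → EuclideanSpace ℝ (Fin d))
      (σ' : Cube n → Fin K → EuclideanSpace ℝ (Fin e)),
      IsRelFeasible f u' v' σ' ∧ relCost u' v' ≤ c := by
  let eJ := (Fintype.equivFin J).symm
  let eL := (Fintype.equivFin L).symm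
  refine ⟨Fintype.card J, Fintype.card L, fun x i => WithLp.toLp 2 fun k => u x i (eJ k),
    fun x i => WithLp.toLp 2 fun k => v x i (eJ k),
    fun x a => WithLp.toLp 2 fun k => σ x a (eL k), ⟨fun x y => ?_, fun x a h => ?_⟩, ?_⟩
  · have h1 : ∀ i, inner ℝ (WithLp.toLp 2 fun k => u x i (eJ k) : EuclideanSpace ℝ _)
        (WithLp.toLp 2 fun k => v y i (eJ k)) = ∑ j, u x i j * v y i j := fun i => by
      rw [PiLp.inner_apply, ← Equiv.sum_comp eJ]
      exact Finset.sum_congr rfl fun k _ => by simp [mul_comm]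
    have h2 : ∀ a, inner ℝ (WithLp.toLp 2 fun k => σ x a (eL k) : EuclideanSpace ℝ _)
        (WithLp.toLp 2 fun k => σ y a (eL k)) = ∑ l, σ x a l * σ y a l := fun i => by
      rw [PiLp.inner_apply, ← Equiv.sum_comp eL]
      exact Finset.sum_congr rfl fun k _ => by simp [mul_comm]
    simp only [h1, h2, hsum]
  · rw [EuclideanSpace.norm_sq_eq]
    exact Finset.sum_eq_zero fun k _ => by simp [hσ x a _ h]
  · have key : ∀ w : Cube n → Fin n → J → ℝ, (∀ x, ∑ i, ∑ j, w x i j ^ 2 ≤ c) →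
        ⨆ x, ∑ i, ‖(WithLp.toLp 2 fun k => w x i (eJ k) : EuclideanSpace ℝ _)‖ ^ 2 ≤ c := by
      refine fun w hw => ciSup_le fun x => le_trans (le_of_eq ?_) (hw x)
      refine Finset.sum_congr rfl fun i _ => ?_
      rw [EuclideanSpace.norm_sq_eq, ← Equiv.sum_comp eJ]
      exact Finset.sum_congr rfl fun k _ => by simp
    exact max_le (key u hu) (key v hv)

theorem relCost_nonneg {n d : ℕ} (u v : Cube n → Fin n → EuclideanSpace ℝ (Fin d)) :
    0 ≤ relCost u v :=
  le_max_of_le_left <| Real.iSup_nonneg fun _ => Finset.sum_nonneg fun _ _ => sq_nonneg _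

theorem sum_left_le_relCost {n d : ℕ} (u v : Cube n → Fin n → EuclideanSpace ℝ (Fin d))
    (x : Cube n) : ∑ i, ‖u x i‖ ^ 2 ≤ relCost u v :=
  le_max_of_le_left <| le_ciSup (f := fun x => ∑ i, ‖u x i‖ ^ 2) (Set.finite_range _).bddAbove x

theorem sum_right_le_relCost {n d : ℕ} (u v : Cube n → Fin n → EuclideanSpace ℝ (Fin d))
    (x : Cube n) : ∑ i, ‖v x i‖ ^ 2 ≤ relCost u v :=
  le_max_of_le_right <| le_ciSup (f := fun x => ∑ i, ‖v x i‖ ^ 2) (Set.finite_range _).bddAbove x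

theorem advRel_le_relCost {n K d e : ℕ} {f : Set (Cube n × Fin K)}
    {u v : Cube n → Fin n → EuclideanSpace ℝ (Fin d)}
    {σ : Cube n → Fin K → EuclideanSpace ℝ (Fin e)} (h : IsRelFeasible f u v σ) :
    advRel f ≤ relCost u v :=
  csInf_le ⟨0, by rintro _ ⟨_, _, u, v, _, _, rfl⟩; exact relCost_nonneg u v⟩
    ⟨d, e, u, v, σ, h, rfl⟩

theorem advRel_nonneg {n K : ℕ} (f : Set (Cube n × Fin K)) : 0 ≤ advRel f :=
  Real.sInf_nonneg <| by rintro _ ⟨_, _, u, v, _, _, rfl⟩; exact relCost_nonneg u v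

/-- A total relation has a feasible relational adversary solution. -/
theorem exists_isRelFeasible {n K : ℕ} {f : Set (Cube n × Fin K)}
    (hf : ∀ x, ∃ a, (x, a) ∈ f) :
    ∃ (d e : ℕ) (u v : Cube n → Fin n → EuclideanSpace ℝ (Fin d))
      (σ : Cube n → Fin K → EuclideanSpace ℝ (Fin e)), IsRelFeasible f u v σ := by
  choose a ha using hf
  -- Trivial solution: `u x i` is the basis vector at `x`, and each of the differing positions
  -- contributes the reciprocal of the Hamming distance. At `x = y` the sum is empty, so the value
  -- `0⁻¹ = 0` is harmless. The vectors `σ` have Gram matrix the identity.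
  let u : Cube n → Fin n → Cube n → ℝ := fun x _ y => if x = y then 1 else 0
  let v : Cube n → Fin n → Cube n → ℝ := fun y _ x =>
    ((Finset.univ.filter fun j => x j ≠ y j).card : ℝ)⁻¹
  let σ : Cube n → Fin K → Cube n → ℝ := fun x b y => if b = a x ∧ x = y then 1 else 0
  obtain ⟨c₁, hc₁⟩ := (Set.finite_range fun x => ∑ i, ∑ j, u x i j ^ 2).bddAbove
  obtain ⟨c₂, hc₂⟩ := (Set.finite_range fun x => ∑ i, ∑ j, v x i j ^ 2).bddAbove
  have hsum : ∀ x y, ∑ i with x i ≠ y i, ∑ j, u x i j * v y i j =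
      1 - ∑ b, ∑ l, σ x b l * σ y b l := by
    intro x y
    have h1 : ∀ i : Fin n, ∑ j, u x i j * v y i j =
        ((Finset.univ.filter fun j => x j ≠ y j).card : ℝ)⁻¹ := fun i => by simp [u, v]
    simp only [h1, Finset.sum_const, nsmul_eq_mul]
    by_cases hxy : x = y
    · subst hxy
      simp [σ, ite_and]
    · have hne : ((Finset.univ.filter fun j => x j ≠ y j).card : ℝ) ≠ 0 := by
        obtain ⟨j, hj⟩ := Function.ne_iff.1 hxy
        exact Nat.cast_ne_zero.2
          (Finset.card_ne_zero_of_mem (Finset.mem_filter.2 ⟨Finset.mem_univ j, hj⟩))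
      rw [mul_inv_cancel₀ hne]
      have : ∑ b, ∑ l, σ x b l * σ y b l = 0 :=
        Finset.sum_eq_zero fun b _ => Finset.sum_eq_zero fun l _ => by
          simp only [σ]
          by_cases hx : x = l
          · rw [if_neg (c := b = a y ∧ y = l) (fun h => hxy (hx.trans h.2.symm)), mul_zero]
          · rw [if_neg (fun h => hx h.2), zero_mul]
      rw [this, sub_zero]
  obtain ⟨d, e, u', v', σ', h, -⟩ := exists_isRelFeasible_of_coordinates f u v σ hsum
    (fun x b l h => if_neg fun hb : b = a x ∧ x = l => h (hb.1 ▸ ha x)) (c := max c₁ c₂)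
    (fun x => le_max_of_le_left (hc₁ ⟨x, rfl⟩)) (fun x => le_max_of_le_right (hc₂ ⟨x, rfl⟩))
  exact ⟨d, e, u', v', σ', h⟩

open Matrix

/-! ### Inner products of superposed tensor vectors -/

section Superposition

variable {T S J : Type*} [Fintype T] [Fintype S] [Fintype J]

/-- The vector `∑ x, h x • (F · x ⊗ a x)`, in coordinates. -/
def superpose (F : T → S → ℝ) (h : S → ℝ) (a : S → J → ℝ) : T × J → ℝ :=
  fun t => ∑ x, h x * F t.1 x * a x t.2

theorem sum_superpose_mul_superpose (F H : T → S → ℝ) (h k : S → ℝ) (a b : S → J → ℝ) :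
    ∑ t, superpose F h a t * superpose H k b t =
      ∑ x, ∑ y, h x * k y * (∑ t, F t x * H t y) * ∑ j, a x j * b y j := by
  simp only [superpose, Finset.sum_mul_sum]
  rw [Finset.sum_comm]
  refine Finset.sum_congr rfl fun x _ => ?_
  rw [Finset.sum_comm]
  refine Finset.sum_congr rfl fun y _ => ?_
  rw [mul_assoc, Finset.sum_mul_sum, Finset.mul_sum, Fintype.sum_prod_type]
  refine Finset.sum_congr rfl fun t _ => ?_
  rw [Finset.mul_sum]
  exact Finset.sum_congr rfl fun j _ => by ring

theorem sum_sum_sum_mul (k : S → T → ℝ) (b : J → S → T → ℝ) :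
    ∑ p, ∑ x, ∑ y, k x y * b p x y = ∑ x, ∑ y, k x y * ∑ p, b p x y := by
  rw [Finset.sum_comm]
  refine Finset.sum_congr rfl fun x _ => ?_
  rw [Finset.sum_comm]
  exact Finset.sum_congr rfl fun y _ => (Finset.mul_sum _ _ _).symm

end Superposition

/-! ### Gram matrices of tensor products -/

section Tensor

variable {ι α : Type*} [Fintype ι] [DecidableEq ι] [Fintype α]

/-- The tensor product of a family of square matrices of the same size, in coordinates. -/
def tensor (A : ι → Matrix α α ℝ) (κ X : ι → α) : ℝ := ∏ p, A p (κ p) (X p)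

theorem sum_tensor_mul_tensor (A B : ι → Matrix α α ℝ) (X Y : ι → α) :
    ∑ κ, tensor A κ X * tensor B κ Y = tensor (fun p => (A p)ᵀ * B p) X Y := by
  simp only [tensor, ← Finset.prod_mul_distrib, mul_apply, transpose_apply, Fintype.prod_sum]

/-- Gram entries factor over the blocks; different matrices `A`, `B` at block `p` allow the `u` and
`v` vectors to be treated asymmetrically. -/
theorem sum_tensor_update_mul_tensor_update (C A B : Matrix α α ℝ) (p : ι) (X Y : ι → α) :
    ∑ κ, tensor (Function.update (fun _ => C) p A) κ X *
        tensor (Function.update (fun _ => C) p B) κ Y =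
      (Aᵀ * B) (X p) (Y p) * ∏ r ∈ Finset.univ.erase p, (Cᵀ * C) (X r) (Y r) := by
  rw [sum_tensor_mul_tensor, tensor, ← Finset.mul_prod_erase _ _ (Finset.mem_univ p)]
  simp only [Function.update_self]
  congr 1
  refine Finset.prod_congr rfl fun r hr => ?_
  simp only [Function.update_of_ne (Finset.ne_of_mem_erase hr)]

end Tensor

/-! ### Witness for the inner function and the composition argument -/

/-- Data extracted from an optimal adversary matrix of `g`: vectors `d b` supported on the fibres
of `g`, a factorization `Cᵀ * C` of the normalized adversary matrix plus the identity, and the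
contractions `G q`. -/
structure AdvWitness {m : ℕ} (g : Cube m → Bool) (lam : ℝ) where
  d : Bool → Cube m → ℝ
  C : Matrix (Cube m) (Cube m) ℝ
  G : Fin m → Matrix (Cube m) (Cube m) ℝ
  H : Fin m → Matrix (Cube m) (Cube m) ℝ
  d_eq_zero : ∀ b x, g x ≠ b → d b x = 0
  sum_d_sq : ∀ b, ∑ x, d b x ^ 2 = 1
  sum_gram : ∀ b b', ∑ x, ∑ y, d b x * d b' y * (Cᵀ * C) x y = 1
  gram_of_eq : ∀ x y, g x = g y → (Cᵀ * C) x y = if x = y then 1 else 0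
  G_of_ne : ∀ q x y, g x ≠ g y → G q x y = lam * (Cᵀ * C) x y * if x q ≠ y q then 1 else 0
  G_contraction : ∀ q, (H q)ᵀ * H q = 1 - (G q)ᵀ * G q

/-- The string with given blocks. -/
def glue {N m : ℕ} (X : Fin N → Cube m) : Cube (N * m) :=
  fun i => X (finProdFinEquiv.symm i).1 (finProdFinEquiv.symm i).2

theorem glue_apply {N m : ℕ} (X : Fin N → Cube m) (p : Fin N) (q : Fin m) :
    glue X (finProdFinEquiv (p, q)) = X p q := by
  simp [glue]

theorem block_glue {N m : ℕ} (X : Fin N → Cube m) (p : Fin N) : block (glue X) p = X p :=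
  funext fun q => glue_apply X p q

namespace AdvWitness

variable {m N : ℕ} {g : Cube m → Bool} {lam : ℝ} (W : AdvWitness g lam)

/-- The weight of a tuple of inputs in the superposition over the fibre above `z`. -/
def weight (z : Cube N) (X : Fin N → Cube m) : ℝ := ∏ p, W.d (z p) (X p)

theorem weight_eq_zero {z : Cube N} {X : Fin N → Cube m} (h : ∃ p, g (X p) ≠ z p) :
    W.weight z X = 0 := by
  obtain ⟨p, hp⟩ := h
  exact Finset.prod_eq_zero (Finset.mem_univ p) (W.d_eq_zero _ _ hp)

theorem sum_weight_sq (z : Cube N) : ∑ X, W.weight z X ^ 2 = 1 := by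
  simp only [weight, ← Finset.prod_pow]
  rw [← Fintype.prod_sum (fun p x => W.d (z p) x ^ 2)]
  exact Finset.prod_eq_one fun p _ => W.sum_d_sq _

/-- Everything factors over the blocks, and each factor is 1 by `sum_gram`. This keeps the constant
1 of the adversary constraint. -/
theorem sum_weight_gram (z w : Cube N) :
    ∑ X, ∑ Y, W.weight z X * W.weight w Y * tensor (fun _ => W.Cᵀ * W.C) X Y = 1 := by
  have h : ∀ X Y, W.weight z X * W.weight w Y * tensor (fun _ => W.Cᵀ * W.C) X Y =
      ∏ p, (W.d (z p) (X p) * W.d (w p) (Y p) * (W.Cᵀ * W.C) (X p) (Y p)) := fun X Y => by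
    simp only [weight, tensor, Finset.prod_mul_distrib]
  simp only [h]
  have h' : ∀ X : Fin N → Cube m, ∑ Y : Fin N → Cube m,
      ∏ p, (W.d (z p) (X p) * W.d (w p) (Y p) * (W.Cᵀ * W.C) (X p) (Y p)) =
      ∏ p, ∑ y, (W.d (z p) (X p) * W.d (w p) y * (W.Cᵀ * W.C) (X p) y) := fun X =>
    (Fintype.prod_sum fun p y => W.d (z p) (X p) * W.d (w p) y * (W.Cᵀ * W.C) (X p) y).symm
  simp only [h']
  rw [← Fintype.prod_sum fun p x => ∑ y, (W.d (z p) x * W.d (w p) y * (W.Cᵀ * W.C) x y)]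
  exact Finset.prod_eq_one fun p _ => W.sum_gram _ _

/-- On a fibre, the Gram matrix of the vectors used away from block `p` is the identity. -/
theorem weight_mul_weight_mul_gram (z : Cube N) (p : Fin N) (X Y : Fin N → Cube m) :
    W.weight z X * W.weight z Y * (((1 : Matrix (Cube m) (Cube m) ℝ) (X p) (Y p)) *
      ∏ r ∈ Finset.univ.erase p, (W.Cᵀ * W.C) (X r) (Y r)) =
    if X = Y then W.weight z X ^ 2 else 0 := by
  by_cases hX : ∃ p, g (X p) ≠ z p
  · simp [W.weight_eq_zero hX]
  by_cases hY : ∃ p, g (Y p) ≠ z p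
  · rw [W.weight_eq_zero hY]
    split_ifs with h
    · subst h; exact absurd hY hX
    · ring
  push Not at hX hY
  have h1 : (((1 : Matrix (Cube m) (Cube m) ℝ) (X p) (Y p)) *
      ∏ r ∈ Finset.univ.erase p, (W.Cᵀ * W.C) (X r) (Y r)) =
      ∏ r, if X r = Y r then (1 : ℝ) else 0 := by
    rw [← Finset.mul_prod_erase _ _ (Finset.mem_univ p), one_apply]
    congr 1
    exact Finset.prod_congr rfl fun r _ => W.gram_of_eq _ _ ((hX r).trans (hY r).symm)
  rw [h1]
  split_ifs with h
  · subst h; simp [sq]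
  · obtain ⟨r, hr⟩ := Function.ne_iff.1 h
    rw [Finset.prod_eq_zero (Finset.mem_univ r) (if_neg hr), mul_zero]

variable {J : Type*} [Fintype J]

/-- Over a single fibre the tensor vectors are orthonormal, so Pythagoras applies. -/
theorem sum_superpose_one_sq (z : Cube N) (p : Fin N) (a : (Fin N → Cube m) → J → ℝ) :
    ∑ t, superpose (tensor (Function.update (fun _ => W.C) p 1)) (W.weight z) a t ^ 2 =
      ∑ X, W.weight z X ^ 2 * ∑ j, a X j ^ 2 := by
  simp only [sq (superpose _ _ _ _)]
  rw [sum_superpose_mul_superpose]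
  simp only [sum_tensor_update_mul_tensor_update, transpose_one, mul_one,
    weight_mul_weight_mul_gram, ite_mul, zero_mul, Finset.sum_ite_eq, Finset.mem_univ, if_true]
  simp only [sq]

/-- Replacing `1` by `G q` loses exactly the squared norm of the same superposition with `H q`,
since `1 - Gᵀ * G = Hᵀ * H`. -/
theorem sum_superpose_G_sq_le (z : Cube N) (p : Fin N) (q : Fin m)
    (a : (Fin N → Cube m) → J → ℝ) :
    ∑ t, superpose (tensor (Function.update (fun _ => W.C) p (W.G q))) (W.weight z) a t ^ 2 ≤
      ∑ X, W.weight z X ^ 2 * ∑ j, a X j ^ 2 := by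
  rw [← W.sum_superpose_one_sq z p a, ← sub_nonneg]
  have h : ∑ t, superpose (tensor (Function.update (fun _ => W.C) p 1)) (W.weight z) a t ^ 2 -
      ∑ t, superpose (tensor (Function.update (fun _ => W.C) p (W.G q))) (W.weight z) a t ^ 2 =
      ∑ t, superpose (tensor (Function.update (fun _ => W.C) p (W.H q))) (W.weight z) a t ^ 2 := by
    simp only [sq (superpose _ _ _ _)]
    simp only [sum_superpose_mul_superpose, sum_tensor_update_mul_tensor_update,
      W.G_contraction, ← Finset.sum_sub_distrib, Matrix.sub_apply, transpose_one, one_mul]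
    exact Finset.sum_congr rfl fun X _ => Finset.sum_congr rfl fun Y _ => by ring
  rw [h]
  exact Finset.sum_nonneg fun _ _ => sq_nonneg _

/-- The block `p` contributes to the composed constraint only if `z p ≠ w p`, and then through
the matrices `G q`. -/
theorem weight_mul_weight_mul_G (hlam : 0 < lam) (z w : Cube N) (p : Fin N) (q : Fin m)
    (X Y : Fin N → Cube m) :
    (if z p ≠ w p then lam⁻¹ * (W.weight z X * W.weight w Y *
      (W.G q (X p) (Y p) * ∏ r ∈ Finset.univ.erase p, (W.Cᵀ * W.C) (X r) (Y r))) else 0) =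
    W.weight z X * W.weight w Y * tensor (fun _ => W.Cᵀ * W.C) X Y *
      if X p q ≠ Y p q then 1 else 0 := by
  by_cases hX : ∃ p, g (X p) ≠ z p
  · simp [W.weight_eq_zero hX]
  by_cases hY : ∃ p, g (Y p) ≠ w p
  · simp [W.weight_eq_zero hY]
  push Not at hX hY
  rw [tensor, ← Finset.mul_prod_erase _ _ (Finset.mem_univ p)]
  by_cases hzw : z p = w p
  -- Equal outer bits put `X p` and `Y p` in one fibre: the Gram entry forces `X p = Y p`, and then
  -- no bit differs.
  · rw [if_neg (not_not.2 hzw), W.gram_of_eq _ _ ((hX p).trans (hzw.trans (hY p).symm))]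
    by_cases h : X p = Y p
    · simp [h]
    · simp [h]
  · rw [if_pos hzw, W.G_of_ne q _ _ (by rw [hX, hY]; exact hzw)]
    field_simp

variable {K d e : ℕ} {f : Set (Cube N × Fin K)}

/-- A solution for the composed relation yields one for the outer relation, with the objective
value divided by `lam`. -/
theorem exists_isRelFeasible_of_compRel (W : AdvWitness g lam) (hlam : 0 < lam)
    {u v : Cube (N * m) → Fin (N * m) → EuclideanSpace ℝ (Fin d)}
    {σ : Cube (N * m) → Fin K → EuclideanSpace ℝ (Fin e)}
    (h : IsRelFeasible (compRel f g) u v σ) :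
    ∃ (d' e' : ℕ) (u' v' : Cube N → Fin N → EuclideanSpace ℝ (Fin d'))
      (σ' : Cube N → Fin K → EuclideanSpace ℝ (Fin e')),
      IsRelFeasible f u' v' σ' ∧ relCost u' v' ≤ relCost u v / lam := by
  -- The factor `1 / lam` is shared equally, so both halves of the cost shrink by `lam`.
  let s := (√lam)⁻¹
  have hs : s * s = lam⁻¹ := by
    simp only [s]; rw [← mul_inv, Real.mul_self_sqrt hlam.le]
  let F : Fin N → Matrix (Cube m) (Cube m) ℝ → (Fin N → Cube m) → (Fin N → Cube m) → ℝ :=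
    fun p A => tensor (Function.update (fun _ => W.C) p A)
  let U : Fin N → Fin m → (Fin N → Cube m) → Fin d → ℝ :=
    fun p q X j => u (glue X) (finProdFinEquiv (p, q)) j
  let V : Fin N → Fin m → (Fin N → Cube m) → Fin d → ℝ :=
    fun p q X j => v (glue X) (finProdFinEquiv (p, q)) j
  let u' : Cube N → Fin N → Fin m × ((Fin N → Cube m) × Fin d) → ℝ :=
    fun z p t => s * superpose (F p 1) (W.weight z) (U p t.1) t.2
  let v' : Cube N → Fin N → Fin m × ((Fin N → Cube m) × Fin d) → ℝ :=
    fun z p t => s * superpose (F p (W.G t.1)) (W.weight z) (V p t.1) t.2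
  let σ' : Cube N → Fin K → (Fin N → Cube m) × Fin e → ℝ :=
    fun z a => superpose (tensor fun _ => W.C) (W.weight z) (fun X l => σ (glue X) a l)
  have hinner : ∀ X Y, ∑ p, ∑ q, (if X p q ≠ Y p q then ∑ j, U p q X j * V p q Y j else 0) =
      1 - ∑ a, ∑ l, σ (glue X) a l * σ (glue Y) a l := by
    intro X Y
    have h1 := h.sum_eq (glue X) (glue Y)
    rw [Finset.sum_filter, ← Equiv.sum_comp finProdFinEquiv, Fintype.sum_prod_type] at h1
    simp only [glue_apply, PiLp.inner_apply] at h1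
    simpa [U, V, mul_comm] using h1
  have hnorm : ∀ (c : Cube (N * m) → Fin (N * m) → EuclideanSpace ℝ (Fin d)) (X),
      ∑ p, ∑ q, ∑ j, c (glue X) (finProdFinEquiv (p, q)) j ^ 2 = ∑ i, ‖c (glue X) i‖ ^ 2 := by
    intro c X
    rw [← Equiv.sum_comp finProdFinEquiv, Fintype.sum_prod_type]
    simp [EuclideanSpace.norm_sq_eq]
  -- The squared weights sum to 1, so the new cost is `lam⁻¹` times an average of old costs.
  have hcost : ∀ (c : Cube (N * m) → Fin (N * m) → EuclideanSpace ℝ (Fin d)) (B : ℝ),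
      (∀ x, ∑ i, ‖c x i‖ ^ 2 ≤ B) → ∀ z : Cube N, ∑ p : Fin N, ∑ q : Fin m, lam⁻¹ *
        ∑ X, W.weight z X ^ 2 * ∑ j, c (glue X) (finProdFinEquiv (p, q)) j ^ 2 ≤ B / lam := by
    intro c B hB z
    calc _ = lam⁻¹ * ∑ X, W.weight z X ^ 2 *
          ∑ p, ∑ q, ∑ j, c (glue X) (finProdFinEquiv (p, q)) j ^ 2 := by
          simp only [Finset.mul_sum]
          symm
          rw [Finset.sum_comm]
          refine Finset.sum_congr rfl fun p _ => ?_
          rw [Finset.sum_comm]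
      _ ≤ lam⁻¹ * ∑ X, W.weight z X ^ 2 * B := by
          gcongr with X _
          rw [hnorm]; exact hB _
      _ = B / lam := by rw [← Finset.sum_mul, W.sum_weight_sq]; ring
  refine exists_isRelFeasible_of_coordinates f u' v' σ' (fun z w => ?_) (fun z a t hza => ?_)
    (fun z => ?_) (fun z => ?_)
  · have hu : ∀ p, ∑ t, u' z p t * v' w p t = ∑ q, ∑ X, ∑ Y, lam⁻¹ * (W.weight z X *
        W.weight w Y * (W.G q (X p) (Y p) * ∏ r ∈ Finset.univ.erase p,
          (W.Cᵀ * W.C) (X r) (Y r))) * ∑ j, U p q X j * V p q Y j := by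
      intro p
      rw [Fintype.sum_prod_type]
      refine Finset.sum_congr rfl fun q _ => ?_
      have : ∀ t, u' z p (q, t) * v' w p (q, t) = lam⁻¹ *
          (superpose (F p 1) (W.weight z) (U p q) t *
            superpose (F p (W.G q)) (W.weight w) (V p q) t) := fun t => by
        simp only [u', v', ← hs]; ring
      simp only [this, ← Finset.mul_sum, sum_superpose_mul_superpose, F,
        sum_tensor_update_mul_tensor_update, transpose_one, one_mul]
      simp only [Finset.mul_sum Finset.univ _ lam⁻¹, mul_assoc]
    have hσ : ∀ a, ∑ t, σ' z a t * σ' w a t = ∑ X, ∑ Y, W.weight z X * W.weight w Y *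
        tensor (fun _ => W.Cᵀ * W.C) X Y * ∑ l, σ (glue X) a l * σ (glue Y) a l := by
      intro a
      simp only [σ', sum_superpose_mul_superpose, sum_tensor_mul_tensor]
    have hp : ∀ p, (if z p ≠ w p then ∑ t, u' z p t * v' w p t else 0) =
        ∑ X, ∑ Y, W.weight z X * W.weight w Y * tensor (fun _ => W.Cᵀ * W.C) X Y *
          ∑ q, (if X p q ≠ Y p q then ∑ j, U p q X j * V p q Y j else 0) := by
      intro p
      rw [hu]
      trans ∑ q, ∑ X, ∑ Y, (if z p ≠ w p then lam⁻¹ * (W.weight z X * W.weight w Y *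
          (W.G q (X p) (Y p) * ∏ r ∈ Finset.univ.erase p, (W.Cᵀ * W.C) (X r) (Y r))) else 0) *
          ∑ j, U p q X j * V p q Y j
      · split_ifs
        · rfl
        · simp
      · simp only [W.weight_mul_weight_mul_G hlam]
        rw [← sum_sum_sum_mul]
        simp only [mul_assoc, ite_mul, one_mul, zero_mul]
    rw [Finset.sum_filter]
    simp only [hp, hσ]
    rw [sum_sum_sum_mul, sum_sum_sum_mul]
    simp only [hinner, mul_sub, mul_one, Finset.sum_sub_distrib, W.sum_weight_gram]
  · refine Finset.sum_eq_zero fun X _ => ?_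
    -- Only tuples lying over `z` carry weight, and for those `(z, a) ∉ f` means that `σ` already
    -- vanishes.
    by_cases hX : ∃ p, g (X p) ≠ z p
    · rw [W.weight_eq_zero hX]; ring
    · push Not at hX
      have h0 := h.norm_sq_eq_zero (glue X) a (fun hmem => hza (by
        simpa [compRel, block_glue, hX] using hmem))
      have h1 : σ (glue X) a = 0 := norm_eq_zero.1 (pow_eq_zero_iff two_ne_zero |>.1 h0)
      simp [h1]
  · refine le_trans (le_of_eq ?_) (hcost u _ (sum_left_le_relCost u v) z)
    refine Finset.sum_congr rfl fun p _ => ?_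
    rw [Fintype.sum_prod_type]
    refine Finset.sum_congr rfl fun q _ => ?_
    rw [← W.sum_superpose_one_sq z p, ← hs, Finset.mul_sum]
    exact Finset.sum_congr rfl fun t _ => by simp only [u', F, U]; ring
  · refine le_trans ?_ (hcost v _ (sum_right_le_relCost u v) z)
    refine Finset.sum_le_sum fun p _ => ?_
    rw [Fintype.sum_prod_type]
    refine Finset.sum_le_sum fun q _ => ?_
    refine le_trans (le_of_eq ?_) (mul_le_mul_of_nonneg_left (W.sum_superpose_G_sq_le z p q _)
      (inv_nonneg.2 hlam.le))
    rw [← hs, Finset.mul_sum]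
    exact Finset.sum_congr rfl fun t _ => by simp only [v', F, V]; ring

end AdvWitness

/-! ### Spectral norm, bilinear forms and Gram factorizations -/

section EuclideanNorm

variable {ι : Type*} [Fintype ι]

/-- The Euclidean norm of a vector. -/
noncomputable def euclNorm (v : ι → ℝ) : ℝ := ‖(WithLp.toLp 2 v : EuclideanSpace ℝ ι)‖

theorem euclNorm_nonneg (v : ι → ℝ) : 0 ≤ euclNorm v := norm_nonneg _

theorem euclNorm_sq (v : ι → ℝ) : euclNorm v ^ 2 = v ⬝ᵥ v := by
  rw [euclNorm, EuclideanSpace.norm_sq_eq]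
  simp [dotProduct, sq]

variable [DecidableEq ι]

theorem dotProduct_mulVec_le_specNorm (M : Matrix ι ι ℝ) (v w : ι → ℝ) :
    v ⬝ᵥ M *ᵥ w ≤ specNorm M * (euclNorm v * euclNorm w) := by
  have h := inner_toEuclideanCLM M (WithLp.toLp 2 v) (WithLp.toLp 2 w)
  refine h.symm.trans_le ((real_inner_le_norm _ _).trans ?_)
  refine (mul_le_mul_of_nonneg_left (ContinuousLinearMap.le_opNorm _ _) (norm_nonneg _)).trans ?_
  exact le_of_eq (by simp only [specNorm, euclNorm]; ring)

/-- The spectral norm is attained by the bilinear form at a pair of unit vectors. -/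
theorem exists_dotProduct_mulVec_eq_specNorm {M : Matrix ι ι ℝ} (hM : 0 < specNorm M) :
    ∃ v w : ι → ℝ, euclNorm v = 1 ∧ euclNorm w = 1 ∧ v ⬝ᵥ M *ᵥ w = specNorm M := by
  set A := toEuclideanCLM (𝕜 := ℝ) M with hA
  have hne : (Metric.sphere (0 : EuclideanSpace ℝ ι) 1).Nonempty := by
    by_contra h
    refine hM.ne' ((norm_eq_zero (a := A)).2 (ContinuousLinearMap.ext fun x => ?_))
    by_contra hx
    have hx0 : x ≠ 0 := fun h0 => hx (by simp [h0])
    exact h ⟨(‖x‖⁻¹ : ℝ) • x, by simp [norm_smul, hx0]⟩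
  obtain ⟨w, hw, hmax⟩ := (isCompact_sphere (0 : EuclideanSpace ℝ ι) 1).exists_isMaxOn hne
    (f := fun w => ‖A w‖) (by fun_prop)
  have hw1 : ‖w‖ = 1 := by simpa using hw
  have hle : ‖A‖ ≤ ‖A w‖ := by
    refine ContinuousLinearMap.opNorm_le_of_unit_norm (norm_nonneg _) fun x hx => ?_
    exact hmax (by simpa using hx)
  have heq : ‖A w‖ = specNorm M :=
    le_antisymm ((A.le_opNorm w).trans_eq (by rw [hw1, mul_one]; rfl)) hle
  -- With `w` maximizing `‖A w‖` on the compact unit sphere, the best left vector is the normalized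
  -- image of `w`.
  refine ⟨(specNorm M)⁻¹ • (A w).ofLp, w.ofLp, ?_, hw1, ?_⟩
  · change ‖(specNorm M)⁻¹ • A w‖ = 1
    rw [norm_smul, heq, norm_inv, Real.norm_of_nonneg hM.le, inv_mul_cancel₀ hM.ne']
  · have h : (A w).ofLp ⬝ᵥ M *ᵥ w.ofLp = ‖A w‖ ^ 2 := by
      rw [← real_inner_self_eq_norm_sq, ← inner_toEuclideanCLM]
    rw [smul_dotProduct, h, heq, smul_eq_mul]
    field_simp

open scoped MatrixOrder in
theorem exists_transpose_mul_self {R : Matrix ι ι ℝ} (hR : R.IsHermitian)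
    (h : ∀ v, 0 ≤ v ⬝ᵥ R *ᵥ v) : ∃ C : Matrix ι ι ℝ, Cᵀ * C = R := by
  have hp : R.PosSemidef := .of_dotProduct_mulVec_nonneg hR (by simpa using h)
  obtain ⟨C, hC⟩ := CStarAlgebra.nonneg_iff_eq_star_mul_self.mp hp.nonneg
  exact ⟨C, by rw [hC, star_eq_conjTranspose, conjTranspose_eq_transpose_of_trivial]⟩

end EuclideanNorm

/-! ### Off-diagonal blocks and their symmetrization -/

section Blocks

variable {ι : Type*} (g : ι → Bool)

/-- The restriction of a vector to a fibre of `g`. -/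
def restr (b : Bool) (v : ι → ℝ) : ι → ℝ := fun x => if g x = b then v x else 0

/-- The symmetric matrix built from the block of `M` with rows over `b` and columns over `!b`. -/
def symmBlock (b : Bool) (M : Matrix ι ι ℝ) : Matrix ι ι ℝ := of fun x y =>
  if g x = b ∧ g y = !b then M x y else if g y = b ∧ g x = !b then M y x else 0

theorem symmBlock_comm (b : Bool) (M : Matrix ι ι ℝ) (x y : ι) :
    symmBlock g b M x y = symmBlock g b M y x := by
  simp only [symmBlock, of_apply]
  cases b <;> cases g x <;> cases g y <;> simp

theorem symmBlock_of_eq (b : Bool) (M : Matrix ι ι ℝ) {x y : ι} (h : g x = g y) :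
    symmBlock g b M x y = 0 := by
  simp only [symmBlock, of_apply]
  cases b <;> cases hx : g x <;> cases hy : g y <;> simp_all

variable [Fintype ι]

theorem euclNorm_restr_sq_add (b : Bool) (v : ι → ℝ) :
    euclNorm (restr g b v) ^ 2 + euclNorm (restr g (!b) v) ^ 2 = euclNorm v ^ 2 := by
  simp only [euclNorm_sq, dotProduct, ← Finset.sum_add_distrib]
  refine Finset.sum_congr rfl fun x _ => ?_
  simp only [restr]
  cases b <;> cases g x <;> simp

theorem dotProduct_symmBlock_mulVec (b : Bool) (M : Matrix ι ι ℝ) (v w : ι → ℝ) :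
    v ⬝ᵥ symmBlock g b M *ᵥ w =
      restr g b v ⬝ᵥ M *ᵥ restr g (!b) w + restr g b w ⬝ᵥ M *ᵥ restr g (!b) v := by
  have h : restr g b w ⬝ᵥ M *ᵥ restr g (!b) v =
      ∑ x, ∑ y, restr g b w y * (M y x * restr g (!b) v x) := by
    rw [Finset.sum_comm]
    simp only [dotProduct, mulVec, Finset.mul_sum]
  rw [h]
  simp only [dotProduct, mulVec, Finset.mul_sum, ← Finset.sum_add_distrib]
  refine Finset.sum_congr rfl fun x _ => Finset.sum_congr rfl fun y _ => ?_
  simp only [restr, symmBlock, of_apply]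
  cases b <;> cases g x <;> cases g y <;> simp <;> ring

/-- Cauchy–Schwarz in the plane; it recombines the norms of the two fibre restrictions. -/
theorem mul_add_mul_le_of_sq_add_sq {a b c d s t : ℝ} (hs : 0 ≤ s) (ht : 0 ≤ t)
    (h1 : a ^ 2 + b ^ 2 = s ^ 2) (h2 : c ^ 2 + d ^ 2 = t ^ 2) : a * d + c * b ≤ s * t := by
  refine (le_abs_self _).trans (abs_le_of_sq_le_sq ?_ (mul_nonneg hs ht))
  rw [mul_pow, ← h1, ← h2]
  nlinarith [sq_nonneg (a * c - b * d)]

variable [DecidableEq ι]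

theorem dotProduct_symmBlock_mulVec_le (b : Bool) (M : Matrix ι ι ℝ) (v w : ι → ℝ) :
    v ⬝ᵥ symmBlock g b M *ᵥ w ≤ specNorm M * (euclNorm v * euclNorm w) := by
  rw [dotProduct_symmBlock_mulVec]
  refine (add_le_add (dotProduct_mulVec_le_specNorm M _ _)
    (dotProduct_mulVec_le_specNorm M _ _)).trans ?_
  rw [← mul_add]
  exact mul_le_mul_of_nonneg_left (mul_add_mul_le_of_sq_add_sq (euclNorm_nonneg _)
    (euclNorm_nonneg _) (euclNorm_restr_sq_add g b v) (euclNorm_restr_sq_add g b w))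
    (norm_nonneg _)

theorem exists_contraction_complement {M : Matrix ι ι ℝ}
    (hM : ∀ v w, v ⬝ᵥ M *ᵥ w ≤ euclNorm v * euclNorm w) :
    ∃ H : Matrix ι ι ℝ, Hᵀ * H = 1 - Mᵀ * M := by
  refine exists_transpose_mul_self ?_ fun v => ?_
  · simp [IsHermitian, conjTranspose_eq_transpose_of_trivial, transpose_sub, transpose_mul]
  · have h1 : v ⬝ᵥ (1 - Mᵀ * M) *ᵥ v = euclNorm v ^ 2 - euclNorm (M *ᵥ v) ^ 2 := by
      rw [sub_mulVec, one_mulVec, dotProduct_sub, ← mulVec_mulVec, euclNorm_sq, euclNorm_sq,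
        dotProduct_mulVec v Mᵀ, vecMul_transpose]
    -- Testing against `M *ᵥ v` itself gives `‖Mv‖² ≤ ‖Mv‖ ‖v‖`, hence `‖Mv‖ ≤ ‖v‖`.
    have h2 := hM (M *ᵥ v) v
    rw [← euclNorm_sq] at h2
    rw [h1]
    nlinarith [euclNorm_nonneg v, euclNorm_nonneg (M *ᵥ v)]

/-- A matrix vanishing on pairs in the same fibre attains its norm on one off-diagonal block. -/
theorem exists_block_attaining {M : Matrix ι ι ℝ} (hM : 0 < specNorm M)
    (h0 : ∀ x y, g x = g y → M x y = 0) :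
    ∃ (b : Bool) (v w : ι → ℝ), restr g b v = v ∧ restr g (!b) w = w ∧
      euclNorm v = 1 ∧ euclNorm w = 1 ∧ v ⬝ᵥ M *ᵥ w = specNorm M := by
  obtain ⟨v, w, hv, hw, hvw⟩ := exists_dotProduct_mulVec_eq_specNorm hM
  have hsplit : v ⬝ᵥ M *ᵥ w = restr g true v ⬝ᵥ M *ᵥ restr g false w +
      restr g false v ⬝ᵥ M *ᵥ restr g true w := by
    simp only [dotProduct, mulVec, Finset.mul_sum, ← Finset.sum_add_distrib]
    refine Finset.sum_congr rfl fun x _ => Finset.sum_congr rfl fun y _ => ?_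
    have := h0 x y
    simp only [restr]
    cases hx : g x <;> cases hy : g y <;> simp_all
  have h1 := dotProduct_mulVec_le_specNorm M (restr g true v) (restr g false w)
  have h2 := dotProduct_mulVec_le_specNorm M (restr g false v) (restr g true w)
  have h3 : euclNorm (restr g true v) * euclNorm (restr g false w) +
      euclNorm (restr g true w) * euclNorm (restr g false v) ≤ 1 * 1 :=
    mul_add_mul_le_of_sq_add_sq zero_le_one zero_le_one
      (by rw [← hv]; exact euclNorm_restr_sq_add g true v)
      (by rw [← hw]; exact euclNorm_restr_sq_add g true w)
  -- The two block values add up to the norm, while their upper bounds add up to at most the norm.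
  -- So both bounds are tight, and some block has a nonzero bound.
  have key : ∃ b, 0 < euclNorm (restr g b v) * euclNorm (restr g (!b) w) ∧
      restr g b v ⬝ᵥ M *ᵥ restr g (!b) w =
        specNorm M * (euclNorm (restr g b v) * euclNorm (restr g (!b) w)) := by
    have e1 : 0 ≤ euclNorm (restr g true v) * euclNorm (restr g false w) :=
      mul_nonneg (euclNorm_nonneg _) (euclNorm_nonneg _)
    have e2 : 0 ≤ euclNorm (restr g false v) * euclNorm (restr g true w) :=
      mul_nonneg (euclNorm_nonneg _) (euclNorm_nonneg _)
    rcases e1.lt_or_eq with e | e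
    · exact ⟨true, e, le_antisymm h1 (by simp only [Bool.not_true]; nlinarith)⟩
    · refine ⟨false, ?_, le_antisymm h2 ?_⟩
      · refine e2.lt_of_ne fun e' => ?_
        rw [← e] at h1; rw [← e'] at h2
        linarith
      · rw [← e] at h1 h3
        simp only [Bool.not_false]
        nlinarith
  obtain ⟨b, hpos, hb⟩ := key
  have hs : ∀ c (r : ℝ) (v : ι → ℝ), restr g c (r • restr g c v) = r • restr g c v := by
    intro c r v
    ext x
    by_cases h : g x = c <;> simp [restr, h]
  have hn : ∀ v : ι → ℝ, euclNorm v ≠ 0 → euclNorm ((euclNorm v)⁻¹ • v) = 1 := by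
    intro v hv
    have : euclNorm ((euclNorm v)⁻¹ • v) = ‖(euclNorm v)⁻¹‖ * euclNorm v :=
      norm_smul (euclNorm v)⁻¹ (WithLp.toLp 2 v : EuclideanSpace ℝ ι)
    rw [this, norm_inv, Real.norm_of_nonneg (euclNorm_nonneg v), inv_mul_cancel₀ hv]
  have n1 := left_ne_zero_of_mul hpos.ne'
  have n2 := right_ne_zero_of_mul hpos.ne'
  refine ⟨b, _, _, hs b (euclNorm (restr g b v))⁻¹ v, hs (!b) (euclNorm (restr g (!b) w))⁻¹ w,
    hn _ n1, hn _ n2, ?_⟩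
  rw [mulVec_smul, dotProduct_smul, smul_dotProduct, hb, smul_eq_mul, smul_eq_mul]
  field_simp

end Blocks

/-! ### Construction of the witness and conclusion -/

/-- Every nonzero feasible adversary matrix gives rise to a witness. -/
theorem nonempty_advWitness {m : ℕ} {g : Cube m → Bool} {Γ : Matrix (Cube m) (Cube m) ℝ}
    (hΓ : IsAdvFeasible g Γ) (hpos : 0 < specNorm Γ) :
    Nonempty (AdvWitness g (specNorm Γ)) := by
  obtain ⟨b, α, β, hα, hβ, hα1, hβ1, hαβ⟩ := exists_block_attaining g hpos hΓ.eq_zero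
  set lam := specNorm Γ with hlam
  let R : Matrix (Cube m) (Cube m) ℝ := 1 + lam⁻¹ • symmBlock g b Γ
  have hRform : ∀ v w, v ⬝ᵥ R *ᵥ w = v ⬝ᵥ w + lam⁻¹ * (v ⬝ᵥ symmBlock g b Γ *ᵥ w) := by
    intro v w
    simp [R, add_mulVec, smul_mulVec, dotProduct_add]
  obtain ⟨C, hC⟩ : ∃ C : Matrix (Cube m) (Cube m) ℝ, Cᵀ * C = R := by
    refine exists_transpose_mul_self ?_ fun v => ?_
    · refine IsHermitian.ext fun x y => ?_
      simp [R, symmBlock_comm g b Γ x y, one_apply, eq_comm]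
    -- The norm bound at the pair `(-v, v)` bounds the form of `Γ'` below by `-lam ‖v‖²`, so adding
    -- the identity gives a positive semidefinite matrix.
    · have h := dotProduct_symmBlock_mulVec_le g b Γ (-v) v
      have hneg : euclNorm (-v) = euclNorm v := norm_neg (WithLp.toLp 2 v)
      rw [neg_dotProduct, hneg, ← sq, euclNorm_sq, ← hlam] at h
      rw [hRform]
      have : -(v ⬝ᵥ v) ≤ lam⁻¹ * (v ⬝ᵥ symmBlock g b Γ *ᵥ v) := by
        rw [le_inv_mul_iff₀ hpos]; linarith
      linarith
  have hG : ∀ q, ∃ H : Matrix (Cube m) (Cube m) ℝ, Hᵀ * H =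
      1 - (symmBlock g b (hadamard Γ (diffMatrix q)))ᵀ *
        symmBlock g b (hadamard Γ (diffMatrix q)) := by
    refine fun q => exists_contraction_complement fun v w => ?_
    refine (dotProduct_symmBlock_mulVec_le g b _ v w).trans ?_
    exact mul_le_of_le_one_left (mul_nonneg (euclNorm_nonneg _) (euclNorm_nonneg _))
      (hΓ.norm_le q)
  choose H hH using hG
  have hz : ∀ c (v : Cube m → ℝ), restr g c v = v → ∀ x, g x ≠ c → v x = 0 := by
    intro c v h x hx
    rw [← h]; exact if_neg hx
  have hzero : ∀ c (v : Cube m → ℝ), restr g c v = v → restr g (!c) v = 0 := by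
    intro c v h
    ext x
    by_cases hx : g x = c
    · simp [restr, hx]
    · simp [restr, hz c v h x hx]
  have hα' := hzero _ _ hα
  have hβ' : restr g b β = 0 := by simpa using hzero _ _ hβ
  have hαα : α ⬝ᵥ α = 1 := by rw [← euclNorm_sq, hα1, one_pow]
  have hββ : β ⬝ᵥ β = 1 := by rw [← euclNorm_sq, hβ1, one_pow]
  have hort : α ⬝ᵥ β = 0 := Finset.sum_eq_zero fun x _ => by
    by_cases hx : g x = b
    · rw [hz _ _ hβ x (by simp [hx]), mul_zero]
    · rw [hz _ _ hα x hx, zero_mul]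
  let d : Bool → Cube m → ℝ := fun c => if c = b then α else β
  have hd : ∀ c, restr g c (d c) = d c := by
    intro c
    by_cases h : c = b
    · simpa [d, h] using hα
    · have : c = !b := by cases b <;> cases c <;> simp_all
      simpa [d, this] using hβ
  refine ⟨{
    d := d
    C := C
    G := fun q => symmBlock g b (hadamard Γ (diffMatrix q))
    H := H
    d_eq_zero := fun c x hx => hz c _ (hd c) x hx
    sum_d_sq := fun c => ?_
    sum_gram := fun c c' => ?_
    gram_of_eq := fun x y hxy => ?_
    G_of_ne := fun q x y hxy => ?_
    G_contraction := hH }⟩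
  · have : ∑ x, d c x ^ 2 = d c ⬝ᵥ d c := by simp only [dotProduct, sq]
    rw [this]
    by_cases h : c = b <;> simp [d, h, hαα, hββ]
  · have : ∑ x, ∑ y, d c x * d c' y * (Cᵀ * C) x y = d c ⬝ᵥ R *ᵥ d c' := by
      rw [hC]
      simp only [dotProduct, mulVec, Finset.mul_sum]
      exact Finset.sum_congr rfl fun x _ => Finset.sum_congr rfl fun y _ => by ring
    rw [this, hRform, dotProduct_symmBlock_mulVec]
    -- On equal fibres the identity part gives 1 and the block part 0; on opposite fibres the roles
    -- are exchanged.
    by_cases h : c = b <;> by_cases h' : c' = b <;>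
      simp [d, h, h', hαα, hββ, hort, dotProduct_comm β α, hα, hβ, hα', hβ', hαβ, hpos.ne']
  · rw [hC]
    simp [R, symmBlock_of_eq g b Γ hxy, one_apply]
  · rw [hC]
    have hne : x ≠ y := fun h => hxy (by rw [h])
    have : symmBlock g b (hadamard Γ (diffMatrix q)) x y =
        symmBlock g b Γ x y * if x q ≠ y q then 1 else 0 := by
      simp only [symmBlock, of_apply, hadamard_apply, diffMatrix, ne_comm (a := y q)]
      split_ifs <;> simp
    rw [this]
    simp [R, one_apply_ne hne, hpos.ne']

end RelAdv

theorem mainTheorem2 {N K m : ℕ} (f : Set (RelAdv.Cube N × Fin K))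
    (hf : ∀ x, ∃ a, (x, a) ∈ f) (g : RelAdv.Cube m → Bool) :
    RelAdv.advRel f * RelAdv.adv g ≤ RelAdv.advRel (RelAdv.compRel f g) := by
  have hcomp := RelAdv.exists_isRelFeasible (f := RelAdv.compRel f g) fun x =>
    hf fun p => g (RelAdv.block x p)
  -- When `advRel f` is positive, dividing by it turns the claim on the supremum into a bound for
  -- each `Γ`.
  rcases (RelAdv.advRel_nonneg f).eq_or_lt with h0 | h0
  · rw [← h0, zero_mul]
    exact RelAdv.advRel_nonneg _
  rw [mul_comm, ← le_div_iff₀ h0]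
  refine Real.sSup_le ?_ (div_nonneg (RelAdv.advRel_nonneg _) h0.le)
  rintro _ ⟨Γ, hΓ, rfl⟩
  rw [le_div_iff₀ h0]
  obtain ⟨d, e, u, v, σ, h⟩ := hcomp
  -- Totality of `f` matters here: the infimum over an empty set would be 0.
  refine le_csInf ⟨_, d, e, u, v, σ, h, rfl⟩ ?_
  rintro _ ⟨d, e, u, v, σ, h, rfl⟩
  rcases (show 0 ≤ RelAdv.specNorm Γ from norm_nonneg _).eq_or_lt with hn | hn
  · rw [← hn, zero_mul]
    exact RelAdv.relCost_nonneg u v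
  obtain ⟨W⟩ := RelAdv.nonempty_advWitness hΓ hn
  obtain ⟨d', e', u', v', σ', h', hle⟩ := W.exists_isRelFeasible_of_compRel hn h
  rw [mul_comm, ← le_div_iff₀ hn]
  exact (RelAdv.advRel_le_relCost h').trans hle
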